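/- Conventions. For a finitely generated group $G$, $b_1(G)$ is the $\mathbb Z$-rank of $G^{\rm ab}$, and $S(G)$ is the set of classes $[\chi]$ of nonzero homomorphisms $\chi:G\to\mathbb R$ modulo multiplication by positive reals, with the quotient topology from $\mathrm{Hom}(G,\mathbb R)\setminus\{0\}$. The set $\Sigma^1(G)\subseteq S(G)$ consists of those $[\chi]$ for which the full subgraph spanned by $\{g\in G:\chi(g)\ge 0\}$ in the Cayley graph of $G$ (edges joining $g$ and $gs$) with respect to a finite generating set is connected (this does not depend on the finite generating set), and $\Sigma^1(G)^c$ is its complement in $S(G)$. A spherical polytope is a set $\{[v] : v=\sum_{j=1}^m a_jv_j\neq 0,\ a_j\ge 0\}$, where $v_1,\dots,v_m$ lie in an open half-space $\{f>0\}$ ($f$ a linear functional) and no $v_i$ is a nonnegative combination of the other $v_j$; its vertices are $[v_1],\dots,[v_m]$. A character $\chi$ (or its class) is transcendental if the ratio of any two nonzero elements of $\chi(G)$ is rational or transcendental. An open hemisphere of $S(G)$ is a set $\{[\chi]:\chi(g)>0\}$ with $g\in G\setminus[G,G]$. Let $\mathcal S$ be the class of finitely generated groups $G$ such that $\Sigma^1(G)^c$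 is non-empty, lies in an open hemisphere of $S(G)$, and has finitely many connected components, each of which is a spherical polytope with transcendental vertices. A group $H$ has property $R^\chi_\infty$ if there is a nonzero homomorphism $\chi:H\to\mathbb R$ with $\chi\circ\varphi=\chi$ for all $\varphi\in\mathrm{Aut}(H)$. Lemma 3.6. Let $G$ be a finitely generated group and let $H$ be a normal subgroup of finite index in $G$ with $b_1(H)=b_1(G)$. If $G\in\mathcal S$, then $H\in\mathcal S$, and $H$ has property $R^\chi_\infty$. Moreover, the restriction map $\mathrm{Hom}(G,\mathbb R)\to\mathrm{Hom}(H,\mathbb R)$ is a linear isomorphism, and the induced bijection $S(G)\to S(H)$ maps $\Sigma^1(G)$ onto $\Sigma^1(H)$. -/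

import Mathlib

noncomputable section

/-- The real vector space `Hom(G, ℝ)` of homomorphisms from `G` to the additive group of the reals
(with Mathlib's pointwise real vector space structure). -/
abbrev Character (G : Type*) [Group G] : Type _ := Additive G →+ ℝ

/-- The value `χ(g)` of a character. -/
def Character.val {G : Type*} [Group G] (χ : Character G) (g : G) : ℝ := χ (Additive.ofMul g)

/-- The topology of pointwise convergence on `Hom(G, ℝ)`; for finitely generated `G` this is the
usual topology of the finite-dimensional real vector space `Hom(G, ℝ)`. -/
instance Character.instTopologicalSpace (G : Type*) [Group G] : TopologicalSpace (Character G) :=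
  TopologicalSpace.induced (fun (χ : Character G) (g : G) => χ.val g) inferInstance

/-- The character sphere `S(G)`: nonzero characters modulo multiplication by positive reals. -/
abbrev CharacterSphere (G : Type*) [Group G] : Type _ := Module.Ray ℝ (Character G)

/-- `S(G)` carries the quotient topology from `Hom(G, ℝ) ∖ {0}`. -/
instance CharacterSphere.instTopologicalSpace (G : Type*) [Group G] :
    TopologicalSpace (CharacterSphere G) :=
  TopologicalSpace.coinduced
    (fun χ : {χ : Character G // χ ≠ 0} => rayOfNeZero ℝ χ.1 χ.2) inferInstance

/-- The Bieri-Neumann-Strebel invariant `Σ¹(G) ⊆ S(G)` of a finitely generated group `G`: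
`[χ] ∈ Σ¹(G)` if the full subgraph spanned by `{g | χ(g) ≥ 0}` in the Cayley graph of `G` with
respect to a finite generating set (edges `g — gs`) is connected. It is standard that whether this
subgraph is connected does not depend on the finite generating set, nor on the representative
`χ` of the class. -/
def Sigma1 (G : Type*) [Group G] : Set (CharacterSphere G) :=
  {x | ∃ (χ : Character G) (hχ : χ ≠ 0), x = rayOfNeZero ℝ χ hχ ∧
    ∃ S : Finset G, Subgroup.closure (S : Set G) = ⊤ ∧
      ((SimpleGraph.mulCayley (S : Set G)).induce {g : G | 0 ≤ χ.val g}).Connected}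

/-- The hemisphere `H_g⁺ = {[χ] | χ(g) > 0}` of `S(G)`. Note that `H_g⁻ = H_{g⁻¹}⁺`. -/
def openHemisphere {G : Type*} [Group G] (g : G) : Set (CharacterSphere G) :=
  {x | ∃ (χ : Character G) (hχ : χ ≠ 0), x = rayOfNeZero ℝ χ hχ ∧ 0 < χ.val g}

/-- `P` is the spherical polytope whose vertices are `[v₁], …, [v_m]`: all the `v_j` lie in an open
half-space, `P` is the set of classes of nonzero nonnegative combinations of the `v_j`, and no `v_i`
is a nonnegative combination of the other `v_j`. -/
structure IsSphericalPolytope {V : Type*} [AddCommGroup V] [Module ℝ V]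
    (P : Set (Module.Ray ℝ V)) {m : ℕ} (v : Fin m → V) : Prop where
  half_space : ∃ f : V →ₗ[ℝ] ℝ, ∀ j, 0 < f (v j)
  eq_cone : P = {x | ∃ (a : Fin m → ℝ) (h : ∑ j, a j • v j ≠ 0),
    (∀ j, 0 ≤ a j) ∧ x = rayOfNeZero ℝ (∑ j, a j • v j) h}
  minimal : ∀ i, ¬ ∃ a : Fin m → ℝ, (∀ j, 0 ≤ a j) ∧ a i = 0 ∧ v i = ∑ j, a j • v j

/-- A character is transcendental if the ratio of any two nonzero elements of its image is rational
or transcendental. -/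
def Character.IsTranscendental {G : Type*} [Group G] (χ : Character G) : Prop :=
  ∀ g h : G, χ.val g ≠ 0 → χ.val h ≠ 0 →
    (∃ q : ℚ, χ.val g / χ.val h = (q : ℝ)) ∨ Transcendental ℚ (χ.val g / χ.val h)

/-- The set of connected components of a subset `A` of a topological space. -/
def componentsOf {X : Type*} [TopologicalSpace X] (A : Set X) : Set (Set X) :=
  {C | ∃ x ∈ A, C = connectedComponentIn A x}

/-- The class `𝒮` of finitely generated groups `G` for which the complement of `Σ¹(G)` in `S(G)` is
non-empty, lies in an open hemisphere, and has finitely many connected components, each of which is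
a spherical polytope with transcendental vertices. -/
structure InClassS (G : Type*) [Group G] : Prop where
  fg : Group.FG G
  compl_nonempty : (Sigma1 G)ᶜ.Nonempty
  hemisphere : ∃ g : G, g ∉ commutator G ∧ (Sigma1 G)ᶜ ⊆ openHemisphere g
  finite_components : (componentsOf (Sigma1 G)ᶜ).Finite
  polytopes : ∀ C ∈ componentsOf (Sigma1 G)ᶜ, ∃ (m : ℕ) (v : Fin m → Character G),
    IsSphericalPolytope C v ∧ ∀ j, (v j).IsTranscendental

/-- Property `R^χ_∞`: there is a non-trivial character fixed by all automorphisms. -/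
def HasRChiInfty (G : Type*) [Group G] : Prop :=
  ∃ χ : Character G, χ ≠ 0 ∧ ∀ (φ : G ≃* G) (g : G), χ.val (φ g) = χ.val g

/-- The first Betti number of a finitely generated group: the `ℤ`-rank of its abelianization. -/
def firstBetti (G : Type*) [Group G] : ℕ :=
  Module.finrank ℤ (Additive (Abelianization G))

end

/-! Let n be the index of H. The map H^ab → G^ab has torsion cokernel, because g^n ∈ H, so equality
of Betti numbers makes its kernel torsion too. Characters of H therefore vanish on H ∩ [G,G], and χ
↦ (g ↦ χ(g^n)/n) inverts restriction (`Character.restrictEquiv`). Restriction respects Σ¹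
(`nonnegConnected_restrict_iff`): with coset representatives on which χ ≤ 0, the retraction G → H, g
↦ g ρ(g)⁻¹, never lowers χ and carries paths in {χ ≥ 0} to paths. So the whole structure of the
complement of Σ¹ passes from G to H. For R^χ_∞, automorphisms permute the components of the
complement of Σ¹. The vertices of a polytope are intrinsic (`IsSphericalPolytope.exists_ray_eq`), so
a vertex class has a finite orbit. An automorphism fixing the class of a transcendental χ fixes χ
itself (`IsTranscendental.eq_one_of_precomp_eq_smul`), so the orbit of χ is finite. Its sum is
invariant, and nonzero since all members are positive at the element defining the hemisphere. -/

/-! ### Characters and their scaling by automorphisms -/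

namespace Character

variable {G : Type*} [Group G]

@[ext]
theorem ext_val {χ ψ : Character G} (h : ∀ g, χ.val g = ψ.val g) : χ = ψ :=
  AddMonoidHom.ext fun g => h g.toMul

@[simp]
theorem val_one (χ : Character G) : χ.val 1 = 0 := map_zero χ

theorem val_mul (χ : Character G) (g h : G) : χ.val (g * h) = χ.val g + χ.val h :=
  map_add χ _ _

theorem val_inv (χ : Character G) (g : G) : χ.val g⁻¹ = -χ.val g := map_neg χ _

theorem val_pow (χ : Character G) (g : G) (n : ℕ) : χ.val (g ^ n) = n * χ.val g := by
  rw [← nsmul_eq_mul]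
  exact map_nsmul χ n _

@[simp]
theorem val_zero (g : G) : (0 : Character G).val g = 0 := rfl

theorem val_smul (r : ℝ) (χ : Character G) (g : G) : (r • χ).val g = r * χ.val g := rfl

theorem val_sum {ι : Type*} (s : Finset ι) (χ : ι → Character G) (g : G) :
    (∑ i ∈ s, χ i).val g = ∑ i ∈ s, (χ i).val g :=
  AddMonoidHom.finsetSum_apply χ s (Additive.ofMul g)

theorem exists_val_neg {χ : Character G} (hχ : χ ≠ 0) : ∃ g, χ.val g < 0 := by
  obtain ⟨g, hg⟩ : ∃ g, χ.val g ≠ 0 := by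
    by_contra! h
    exact hχ (ext_val h)
  rcases lt_or_gt_of_ne hg with h | h
  · exact ⟨g, h⟩
  · exact ⟨g⁻¹, by rw [val_inv]; linarith⟩

theorem val_eq_zero_of_mem_commutator (χ : Character G) {g : G} (hg : g ∈ commutator G) :
    χ.val g = 0 :=
  Abelianization.commutator_subset_ker (AddMonoidHom.toMultiplicativeRight χ) hg

/-- The character with a given additive function as its values. -/
def ofVal (f : G → ℝ) (hf : ∀ g h, f (g * h) = f g + f h) : Character G :=
  AddMonoidHom.mk' (fun g => f g.toMul) fun g h => hf g.toMul h.toMul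

@[simp]
theorem val_ofVal (f : G → ℝ) (hf : ∀ g h, f (g * h) = f g + f h) (g : G) :
    (ofVal f hf).val g = f g := rfl

theorem continuous_val (g : G) : Continuous fun χ : Character G => χ.val g :=
  (continuous_apply g).comp continuous_induced_dom

theorem continuous_iff {X : Type*} [TopologicalSpace X] {f : X → Character G} :
    Continuous f ↔ ∀ g, Continuous fun x => (f x).val g := by
  refine ⟨fun hf g => (continuous_val g).comp hf, fun h => ?_⟩
  exact continuous_induced_rng.2 (continuous_pi h)

/-- Precomposition with an automorphism. -/
def precomp (φ : G ≃* G) : Character G ≃ₗ[ℝ] Character G where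
  toFun χ := ofVal (fun g => χ.val (φ g)) fun g h => by rw [map_mul, val_mul]
  invFun χ := ofVal (fun g => χ.val (φ.symm g)) fun g h => by rw [map_mul, val_mul]
  map_add' _ _ := rfl
  map_smul' _ _ := rfl
  left_inv χ := by ext g; simp
  right_inv χ := by ext g; simp

@[simp]
theorem val_precomp (φ : G ≃* G) (χ : Character G) (g : G) :
    (precomp φ χ).val g = χ.val (φ g) := rfl

theorem precomp_symm (φ : G ≃* G) : (precomp φ).symm = precomp φ.symm := rfl

theorem continuous_precomp (φ : G ≃* G) : Continuous (precomp φ) :=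
  continuous_iff.2 fun g => continuous_val (φ g)

/-- A positive factor by which an automorphism scales a nonzero transcendental character of a
finitely generated group is `1`. -/
theorem IsTranscendental.eq_one_of_precomp_eq_smul [Group.FG G] {χ : Character G}
    (ht : χ.IsTranscendental) (hχ : χ ≠ 0) {θ : G ≃* G} {r : ℝ} (hr : 0 < r)
    (h : ∀ g, χ.val (θ g) = r * χ.val g) : r = 1 := by
  -- The value group is a finitely generated ℤ-module stable under multiplication by r and by r⁻¹,
  -- so both are algebraic integers.
  let N : Submodule ℤ ℝ := AddSubgroup.toIntSubmodule (AddMonoidHom.range χ)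
  have hmem (g : G) : χ.val g ∈ N := ⟨Additive.ofMul g, rfl⟩
  have hN : N ≠ ⊥ := by
    obtain ⟨g, hg⟩ := exists_val_neg hχ
    intro hbot
    have := hmem g
    rw [hbot, Submodule.mem_bot] at this
    exact hg.ne this
  have hfg : N.FG := by
    rw [Submodule.fg_iff_addSubgroup_fg, AddSubgroup.toIntSubmodule_toAddSubgroup,
      ← AddGroup.fg_iff_addSubgroup_fg]
    infer_instance
  have key {x : ℝ} {ψ : G ≃* G} (hx : ∀ g, χ.val (ψ g) = x * χ.val g) : IsIntegral ℤ x := by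
    refine isIntegral_of_smul_mem_submodule N hN hfg x ?_
    rintro _ ⟨a, rfl⟩
    have := hmem (ψ a.toMul)
    rw [hx] at this
    exact this
  have hinv (g : G) : χ.val (θ.symm g) = r⁻¹ * χ.val g := by
    have := h (θ.symm g)
    rw [MulEquiv.apply_symm_apply] at this
    rw [this, inv_mul_cancel_left₀ hr.ne']
  have hi := key h
  have hi' := key hinv
  obtain ⟨g, hg⟩ := exists_val_neg hχ
  have hrat : ∃ q : ℚ, r = q := by
    have hquot : χ.val (θ g) / χ.val g = r := by rw [h, mul_div_cancel_right₀ _ hg.ne]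
    have := ht (θ g) g (by rw [h]; exact mul_ne_zero hr.ne' hg.ne) hg.ne
    rw [hquot] at this
    refine this.resolve_right fun htr => htr ?_
    exact (hi.tower_top (A := ℚ)).isAlgebraic
  -- A positive rational algebraic integer is a positive integer; applied to r and r⁻¹, this forces
  -- r = 1.
  have hint {x : ℝ} (hx : IsIntegral ℤ x) (hq : ∃ q : ℚ, x = q) (hpos : 0 < x) : 1 ≤ x := by
    obtain ⟨q, rfl⟩ := hq
    have hq : IsIntegral ℤ q :=
      (isIntegral_algebraMap_iff (R := ℤ) (A := ℚ) (B := ℝ) (algebraMap ℚ ℝ).injective).1 hx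
    obtain ⟨n, rfl⟩ := IsIntegrallyClosed.isIntegral_iff.1 hq
    simp only [eq_intCast, Rat.cast_intCast] at hpos ⊢
    exact_mod_cast hpos
  refine le_antisymm ?_ (hint hi hrat hr)
  have := hint hi' (let ⟨q, hq⟩ := hrat; ⟨q⁻¹, by rw [hq, Rat.cast_inv]⟩) (inv_pos.2 hr)
  exact (one_le_inv₀ hr).1 this

end Character

/-! ### Character spheres and connected components -/

section Rays

variable {G H : Type*} [Group G] [Group H]

theorem CharacterSphere.continuous_map (e : Character G ≃ₗ[ℝ] Character H) (he : Continuous e) :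
    Continuous (Module.Ray.map e : CharacterSphere G → CharacterSphere H) := by
  refine continuous_coinduced_dom.2 ?_
  have h : Continuous fun χ : {χ : Character G // χ ≠ 0} =>
      (⟨e χ.1, e.map_ne_zero_iff.2 χ.2⟩ : {χ : Character H // χ ≠ 0}) :=
    (he.comp continuous_subtype_val).subtype_mk _
  exact (continuous_coinduced_rng (f := fun χ : {χ : Character H // χ ≠ 0} =>
    rayOfNeZero ℝ χ.1 χ.2)).comp h

/-- The homeomorphism of character spheres induced by a bicontinuous linear equivalence. -/
def CharacterSphere.mapHomeomorph (e : Character G ≃ₗ[ℝ] Character H) (he : Continuous e)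
    (he' : Continuous e.symm) : CharacterSphere G ≃ₜ CharacterSphere H where
  toEquiv := Module.Ray.map e
  continuous_toFun := continuous_map e he
  continuous_invFun := continuous_map e.symm he'

theorem CharacterSphere.coe_mapHomeomorph (e : Character G ≃ₗ[ℝ] Character H)
    (he : Continuous e) (he' : Continuous e.symm) :
    (mapHomeomorph e he he' : CharacterSphere G → CharacterSphere H) = Module.Ray.map e := rfl

theorem componentsOf_image {X Y : Type*} [TopologicalSpace X] [TopologicalSpace Y] (f : X ≃ₜ Y)
    (A : Set X) : componentsOf (f '' A) = Set.image f '' componentsOf A := by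
  ext C
  constructor
  · rintro ⟨_, ⟨x, hx, rfl⟩, rfl⟩
    exact ⟨_, ⟨x, hx, rfl⟩, f.image_connectedComponentIn hx⟩
  · rintro ⟨_, ⟨x, hx, rfl⟩, rfl⟩
    exact ⟨f x, ⟨x, hx, rfl⟩, f.image_connectedComponentIn hx⟩

theorem subset_of_mem_componentsOf {X : Type*} [TopologicalSpace X] {A C : Set X}
    (hC : C ∈ componentsOf A) : C ⊆ A := by
  obtain ⟨x, -, rfl⟩ := hC
  exact connectedComponentIn_subset A x

theorem nonempty_of_mem_componentsOf {X : Type*} [TopologicalSpace X] {A C : Set X}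
    (hC : C ∈ componentsOf A) : C.Nonempty := by
  obtain ⟨x, hx, rfl⟩ := hC
  exact ⟨x, mem_connectedComponentIn hx⟩

end Rays

/-! ### Spherical polytopes and uniqueness of their vertices -/

namespace IsSphericalPolytope

variable {V W : Type*} [AddCommGroup V] [Module ℝ V] [AddCommGroup W] [Module ℝ W]
  {P : Set (Module.Ray ℝ V)} {m n : ℕ} {v : Fin m → V} {w : Fin n → V}

theorem map (hP : IsSphericalPolytope P v) (e : V ≃ₗ[ℝ] W) :
    IsSphericalPolytope (Module.Ray.map e '' P) (fun j => e (v j)) where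
  half_space := by
    obtain ⟨f, hf⟩ := hP.half_space
    exact ⟨f ∘ₗ e.symm.toLinearMap, fun j => by simpa using hf j⟩
  eq_cone := by
    have hsum (a : Fin m → ℝ) : ∑ j, a j • e (v j) = e (∑ j, a j • v j) := by simp
    rw [hP.eq_cone]
    ext y
    constructor
    · rintro ⟨_, ⟨a, h, ha, rfl⟩, rfl⟩
      have h' : ∑ j, a j • e (v j) ≠ 0 := by rwa [hsum, e.map_ne_zero_iff]
      refine ⟨a, h', ha, ?_⟩
      rw [Module.Ray.map_apply]
      congr 1
      exact (hsum a).symm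
    · rintro ⟨a, h', ha, rfl⟩
      have h : ∑ j, a j • v j ≠ 0 := by rwa [hsum, e.map_ne_zero_iff] at h'
      refine ⟨_, ⟨a, h, ha, rfl⟩, ?_⟩
      rw [Module.Ray.map_apply]
      congr 1
      exact (hsum a).symm
  minimal := by
    rintro i ⟨a, ha, hi, h⟩
    refine hP.minimal i ⟨a, ha, hi, e.injective ?_⟩
    simpa using h

theorem ne_zero (hP : IsSphericalPolytope P v) (j : Fin m) : v j ≠ 0 := by
  obtain ⟨f, hf⟩ := hP.half_space
  intro h
  simpa [h] using hf j

theorem ray_mem (hP : IsSphericalPolytope P v) (j : Fin m) :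
    rayOfNeZero ℝ (v j) (hP.ne_zero j) ∈ P := by
  refine hP.eq_cone.symm.subset ?_
  have hs : ∑ i, (Pi.single j 1 : Fin m → ℝ) i • v i = v j := by
    simp [Pi.single_apply]
  refine ⟨Pi.single j 1, by rw [hs]; exact hP.ne_zero j, fun i => ?_, ?_⟩
  · rw [Pi.single_apply]
    split_ifs <;> norm_num
  · congr 1
    exact hs.symm

theorem exists_eq_sum (hP : IsSphericalPolytope P v) {x : V} (hx : x ≠ 0)
    (hmem : rayOfNeZero ℝ x hx ∈ P) : ∃ a : Fin m → ℝ, (∀ j, 0 ≤ a j) ∧ x = ∑ j, a j • v j := by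
  rw [hP.eq_cone] at hmem
  obtain ⟨a, h, ha, heq⟩ := hmem
  obtain ⟨r, hr, h1⟩ := ((ray_eq_iff hx h).1 heq).symm.exists_nonneg_left h
  refine ⟨fun j => r * a j, fun j => mul_nonneg hr (ha j), ?_⟩
  rw [← h1, Finset.smul_sum]
  simp [mul_smul]

/-- The vertices of a spherical polytope are determined by the polytope. -/
theorem exists_ray_eq (hv : IsSphericalPolytope P v) (hw : IsSphericalPolytope P w) (j : Fin n) :
    ∃ k, rayOfNeZero ℝ (w j) (hw.ne_zero j) = rayOfNeZero ℝ (v k) (hv.ne_zero k) := by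
  classical
  obtain ⟨f, hf⟩ := hw.half_space
  obtain ⟨a, ha, haw⟩ := hv.exists_eq_sum _ (hw.ray_mem j)
  choose b hb hbv using fun k => hw.exists_eq_sum _ (hv.ray_mem k)
  -- Expanding w j in the v k, and these in turn in the w l, expresses w j through the w l. The aim
  -- is to show that only w j occurs.
  let c : Fin n → ℝ := fun l => ∑ k, a k * b k l
  have hc (l) : 0 ≤ c l := Finset.sum_nonneg fun k _ => mul_nonneg (ha k) (hb k l)
  have hcw : w j = ∑ l, c l • w l := by
    calc w j = ∑ k, a k • v k := haw
      _ = ∑ k, a k • ∑ l, b k l • w l := by simp_rw [← hbv]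
      _ = ∑ k, ∑ l, (a k * b k l) • w l := by simp_rw [Finset.smul_sum, smul_smul]
      _ = ∑ l, c l • w l := by rw [Finset.sum_comm]; simp_rw [c, Finset.sum_smul]
  have hsplit : w j = c j • w j + ∑ l ∈ Finset.univ.erase j, c l • w l := by
    rw [Finset.add_sum_erase _ (fun l => c l • w l) (Finset.mem_univ j)]
    exact hcw
  -- Otherwise one could solve for w j and contradict minimality.
  have hcj : 1 ≤ c j := by
    by_contra! hlt
    refine hw.minimal j ⟨fun l => if l = j then 0 else (1 - c j)⁻¹ * c l, fun l => ?_, by simp, ?_⟩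
    · dsimp only
      split_ifs
      · rfl
      · exact mul_nonneg (inv_nonneg.2 (by linarith)) (hc l)
    · have h1 : (1 - c j) • w j = ∑ l ∈ Finset.univ.erase j, c l • w l := by
        rw [sub_smul, one_smul, sub_eq_iff_eq_add']
        exact hsplit
      rw [← Finset.add_sum_erase _ _ (Finset.mem_univ j)]
      simp only [if_true, zero_smul, zero_add]
      calc w j = (1 - c j)⁻¹ • (1 - c j) • w j := by
            rw [inv_smul_smul₀ (by linarith)]
        _ = ∑ l ∈ Finset.univ.erase j, ((1 - c j)⁻¹ * c l) • w l := by
            rw [h1, Finset.smul_sum]; simp_rw [smul_smul]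
        _ = _ := Finset.sum_congr rfl fun l hl => by rw [if_neg (Finset.ne_of_mem_erase hl)]
  -- Apply f: since c j ≥ 1, the remaining nonnegative terms sum to at most 0.
  have hzero (l) (hl : l ≠ j) : c l = 0 := by
    have h1 := congrArg f hsplit
    simp only [map_add, map_smul, map_sum, smul_eq_mul] at h1
    have hnn : ∀ l ∈ Finset.univ.erase j, 0 ≤ c l * f (w l) :=
      fun l _ => mul_nonneg (hc l) (hf l).le
    have h2 : ∑ l ∈ Finset.univ.erase j, c l * f (w l) = 0 :=
      le_antisymm (by nlinarith [hf j]) (Finset.sum_nonneg hnn)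
    have h3 := (Finset.sum_eq_zero_iff_of_nonneg hnn).1 h2 l (by simpa using hl)
    exact (mul_eq_zero.1 h3).resolve_right (hf l).ne'
  -- Any v k that really contributes to w j is a multiple of w j.
  obtain ⟨k, hk⟩ : ∃ k, a k ≠ 0 := by
    by_contra! h
    exact hw.ne_zero j (by rw [haw]; simp [h])
  have hbk (l) (hl : l ≠ j) : b k l = 0 := by
    have h1 := (Finset.sum_eq_zero_iff_of_nonneg
      fun k _ => mul_nonneg (ha k) (hb k l)).1 (hzero l hl) k (Finset.mem_univ k)
    exact (mul_eq_zero.1 h1).resolve_left hk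
  have hvk : v k = b k j • w j := by
    refine (hbv k).trans (Finset.sum_eq_single j (fun l _ hl => ?_) (by simp))
    rw [hbk l hl, zero_smul]
  refine ⟨k, (ray_eq_iff _ _).2 ?_⟩
  rw [hvk]
  exact SameRay.sameRay_nonneg_smul_right _ (hb k j)

end IsSphericalPolytope

/-- The vertices of those connected components of `A` that are spherical polytopes. -/
def vertexRays {G : Type*} [Group G] (A : Set (CharacterSphere G)) : Set (CharacterSphere G) :=
  {x | ∃ C ∈ componentsOf A, ∃ (m : ℕ) (v : Fin m → Character G) (hv : IsSphericalPolytope C v)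
    (j : Fin m), x = rayOfNeZero ℝ (v j) (hv.ne_zero j)}

/-- `vertexRays` ranges over all vertex systems of a component, but by `exists_ray_eq` one system
already gives every ray. -/
theorem vertexRays_finite {G : Type*} [Group G] {A : Set (CharacterSphere G)}
    (hA : (componentsOf A).Finite) : (vertexRays A).Finite := by
  have h : vertexRays A ⊆ ⋃ C ∈ componentsOf A, {x | ∃ (m : ℕ) (v : Fin m → Character G)
      (hv : IsSphericalPolytope C v) (j : Fin m), x = rayOfNeZero ℝ (v j) (hv.ne_zero j)} := by
    rintro x ⟨C, hC, hx⟩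
    exact Set.mem_biUnion hC hx
  refine (hA.biUnion fun C _ => ?_).subset h
  by_cases hP : ∃ (m : ℕ) (v : Fin m → Character G), IsSphericalPolytope C v
  · obtain ⟨m, v, hv⟩ := hP
    refine (Set.finite_range fun k => rayOfNeZero ℝ (v k) (hv.ne_zero k)).subset ?_
    rintro x ⟨n, w, hw, j, rfl⟩
    obtain ⟨k, hk⟩ := hv.exists_ray_eq hw j
    exact ⟨k, hk.symm⟩
  · refine Set.finite_empty.subset ?_
    rintro x ⟨n, w, hw, -⟩
    exact (hP ⟨n, w, hw⟩).elim

theorem vertexRays_subset {G : Type*} [Group G] (A : Set (CharacterSphere G)) :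
    vertexRays A ⊆ A := by
  rintro _ ⟨C, hC, m, v, hv, j, rfl⟩
  exact subset_of_mem_componentsOf hC (hv.ray_mem j)

theorem map_mem_vertexRays {G : Type*} [Group G] {A : Set (CharacterSphere G)}
    (e : Character G ≃ₗ[ℝ] Character G) (he : Continuous e) (he' : Continuous e.symm)
    (hA : Module.Ray.map e '' A = A) {x : CharacterSphere G} (hx : x ∈ vertexRays A) :
    Module.Ray.map e x ∈ vertexRays A := by
  obtain ⟨C, hC, m, v, hv, j, rfl⟩ := hx
  refine ⟨Module.Ray.map e '' C, ?_, m, _, hv.map e, j, Module.Ray.map_apply _ _ _⟩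
  have := componentsOf_image (CharacterSphere.mapHomeomorph e he he') A
  rw [CharacterSphere.coe_mapHomeomorph, hA] at this
  rw [this]
  exact Set.mem_image_of_mem _ hC

/-! ### Paths in the Cayley graph and invariance of Σ¹ -/

section CayleyPaths

variable {G H : Type*} [Group G] [Group H]

/-- A step along an edge of the Cayley graph (or a constant step) inside `{g | 0 ≤ χ g}`. -/
def NonnegStep (S : Set G) (χ : Character G) (a b : G) : Prop :=
  0 ≤ χ.val a ∧ 0 ≤ χ.val b ∧ (a⁻¹ * b ∈ S ∨ b⁻¹ * a ∈ S)

theorem reachable_of_reflTransGen_nonnegStep {S : Set G} {χ : Character G} {a b : G}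
    (h : Relation.ReflTransGen (NonnegStep S χ) a b) (ha : 0 ≤ χ.val a) :
    ∃ hb : 0 ≤ χ.val b, ((SimpleGraph.mulCayley S).induce {g : G | 0 ≤ χ.val g}).Reachable
      ⟨a, ha⟩ ⟨b, hb⟩ := by
  induction h with
  | refl => exact ⟨ha, SimpleGraph.Reachable.refl _⟩
  | @tail b c _ hbc ih =>
    obtain ⟨hb, ih⟩ := ih
    refine ⟨hbc.2.1, ih.trans ?_⟩
    by_cases heq : b = c
    · subst heq
      exact SimpleGraph.Reachable.refl _
    · refine SimpleGraph.Adj.reachable ?_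
      rw [SimpleGraph.induce_adj, SimpleGraph.mulCayley_adj]
      exact ⟨heq, hbc.2.2⟩

theorem reflTransGen_nonnegStep_of_reachable {S : Set G} {χ : Character G}
    {a b : {g : G | 0 ≤ χ.val g}}
    (h : ((SimpleGraph.mulCayley S).induce {g : G | 0 ≤ χ.val g}).Reachable a b) :
    Relation.ReflTransGen (NonnegStep S χ) a b := by
  rw [SimpleGraph.reachable_iff_reflTransGen] at h
  refine h.lift Subtype.val fun x y hxy => ⟨x.2, y.2, ?_⟩
  rw [SimpleGraph.induce_adj, SimpleGraph.mulCayley_adj] at hxy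
  exact hxy.2

theorem connected_nonneg_iff {S : Set G} {χ : Character G} :
    ((SimpleGraph.mulCayley S).induce {g : G | 0 ≤ χ.val g}).Connected ↔
      ∀ g, 0 ≤ χ.val g → Relation.ReflTransGen (NonnegStep S χ) 1 g := by
  constructor
  · intro h g hg
    exact reflTransGen_nonnegStep_of_reachable (h.preconnected ⟨1, χ.val_one.ge⟩ ⟨g, hg⟩)
  · intro h
    have h1 (x : {g : G | 0 ≤ χ.val g}) : ((SimpleGraph.mulCayley S).induce
        {g : G | 0 ≤ χ.val g}).Reachable ⟨1, χ.val_one.ge⟩ x :=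
      (reachable_of_reflTransGen_nonnegStep (h x x.2) χ.val_one.ge).2
    rw [SimpleGraph.connected_iff]
    exact ⟨fun x y => (h1 x).symm.trans (h1 y), ⟨⟨1, χ.val_one.ge⟩⟩⟩

/-- Every g or its inverse has nonnegative value. Hence generation can be dropped from the criterion
for Σ¹. -/
theorem closure_eq_top_of_nonnegStep {S : Set G} {χ : Character G}
    (h : ∀ g, 0 ≤ χ.val g → Relation.ReflTransGen (NonnegStep S χ) 1 g) :
    Subgroup.closure S = ⊤ := by
  have hmem {g : G} (hg : Relation.ReflTransGen (NonnegStep S χ) 1 g) :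
      g ∈ Subgroup.closure S := by
    induction hg with
    | refl => exact one_mem _
    | @tail b c _ hbc ih =>
      rcases hbc.2.2 with hs | hs
      · have := mul_mem ih (Subgroup.subset_closure hs)
        rwa [mul_inv_cancel_left] at this
      · have := mul_mem ih (inv_mem (Subgroup.subset_closure hs))
        rwa [mul_inv_rev, inv_inv, mul_inv_cancel_left] at this
  refine (Subgroup.eq_top_iff' _).2 fun g => ?_
  rcases le_total 0 (χ.val g) with hg | hg
  · exact hmem (h g hg)
  · rw [← inv_inv g]
    refine inv_mem (hmem (h _ ?_))
    rw [χ.val_inv]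
    linarith

/-- Connectivity of `{g | 0 ≤ χ g}` in some Cayley graph with finitely many generators. -/
def NonnegConnected (χ : Character G) : Prop :=
  ∃ S : Finset G, ∀ g, 0 ≤ χ.val g → Relation.ReflTransGen (NonnegStep (S : Set G) χ) 1 g

theorem mem_Sigma1_iff {x : CharacterSphere G} :
    x ∈ Sigma1 G ↔ ∃ (χ : Character G) (hχ : χ ≠ 0), x = rayOfNeZero ℝ χ hχ ∧
      NonnegConnected χ := by
  refine exists_congr fun χ => exists_congr fun hχ => and_congr_right fun _ =>
    exists_congr fun S => ?_
  rw [connected_nonneg_iff]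
  exact ⟨fun h => h.2, fun h => ⟨closure_eq_top_of_nonnegStep h, h⟩⟩

/-- A linear equivalence of character spaces preserving `NonnegConnected` maps `Σ¹` onto `Σ¹`. -/
theorem Sigma1_eq_image (e : Character G ≃ₗ[ℝ] Character H)
    (he : ∀ χ, χ ≠ 0 → (NonnegConnected (e χ) ↔ NonnegConnected χ)) :
    Sigma1 H = Module.Ray.map e '' Sigma1 G := by
  ext y
  constructor
  · intro hy
    obtain ⟨ψ, hψ, rfl, hc⟩ := mem_Sigma1_iff.1 hy
    have hne : e.symm ψ ≠ 0 := e.symm.map_ne_zero_iff.2 hψ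
    refine ⟨rayOfNeZero ℝ (e.symm ψ) hne, mem_Sigma1_iff.2 ⟨_, hne, rfl, ?_⟩, ?_⟩
    · rwa [← he _ hne, e.apply_symm_apply]
    · rw [Module.Ray.map_apply]
      congr 1
      exact e.apply_symm_apply ψ
  · rintro ⟨x, hx, rfl⟩
    obtain ⟨χ, hχ, rfl, hc⟩ := mem_Sigma1_iff.1 hx
    exact mem_Sigma1_iff.2 ⟨e χ, e.map_ne_zero_iff.2 hχ, Module.Ray.map_apply _ _ _,
      (he χ hχ).2 hc⟩

theorem NonnegConnected.precomp {χ : Character G} (h : NonnegConnected χ) (φ : G ≃* G) :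
    NonnegConnected (Character.precomp φ χ) := by
  classical
  obtain ⟨S, hS⟩ := h
  refine ⟨S.image φ.symm, fun g hg => ?_⟩
  have h1 := (hS (φ g) hg).lift (p := NonnegStep (↑(S.image φ.symm)) (Character.precomp φ χ))
    φ.symm fun a b hab => ?_
  · simpa [Function.onFun] using h1
  · refine ⟨by simpa using hab.1, by simpa using hab.2.1, hab.2.2.imp (fun hs => ?_) fun hs => ?_⟩
    all_goals
      rw [← map_inv, ← map_mul, Finset.coe_image]
      exact Set.mem_image_of_mem _ hs

theorem nonnegConnected_precomp_iff {χ : Character G} (φ : G ≃* G) :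
    NonnegConnected (Character.precomp φ χ) ↔ NonnegConnected χ := by
  refine ⟨fun h => ?_, fun h => h.precomp φ⟩
  have := h.precomp φ.symm
  rwa [← Character.precomp_symm, LinearEquiv.symm_apply_apply] at this

theorem image_compl_Sigma1_precomp (φ : G ≃* G) :
    Module.Ray.map (Character.precomp φ) '' (Sigma1 G)ᶜ = (Sigma1 G)ᶜ := by
  rw [Set.image_compl_eq (Module.Ray.map (Character.precomp φ)).bijective,
    ← Sigma1_eq_image _ fun χ _ => nonnegConnected_precomp_iff φ]

end CayleyPaths

/-! ### Σ¹ and normal subgroups of finite index -/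

section FiniteIndex

variable {G : Type*} [Group G] (H : Subgroup G)

/-- Restriction of characters to a subgroup. -/
def Character.restrict : Character G →ₗ[ℝ] Character H where
  toFun χ := Character.ofVal (fun h => χ.val h) fun _ _ => χ.val_mul _ _
  map_add' _ _ := rfl
  map_smul' _ _ := rfl

@[simp]
theorem Character.val_restrict (χ : Character G) (h : H) :
    (Character.restrict H χ).val h = χ.val h := rfl

variable [H.Normal] [H.FiniteIndex]

/-- Coset representatives on which a given nonzero character is nonpositive. -/
theorem exists_rep_val_nonpos {χ : Character G} (hχ : χ ≠ 0) :
    ∃ ρ : G ⧸ H → G, ρ 1 = 1 ∧ (∀ q, (ρ q : G ⧸ H) = q) ∧ ∀ q, χ.val (ρ q) ≤ 0 := by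
  obtain ⟨t₀, ht₀⟩ := Character.exists_val_neg hχ
  obtain ⟨t, htH, ht⟩ : ∃ t ∈ H, χ.val t < 0 := by
    refine ⟨t₀ ^ H.index, H.pow_index_mem t₀, ?_⟩
    rw [χ.val_pow]
    exact mul_neg_of_pos_of_neg (Nat.cast_pos.2 (Nat.pos_of_ne_zero H.index_ne_zero_of_finite)) ht₀
  have key (q : G ⧸ H) : ∃ r : G, (q = 1 → r = 1) ∧ (r : G ⧸ H) = q ∧ χ.val r ≤ 0 := by
    by_cases hq : q = 1
    · exact ⟨1, fun _ => rfl, hq.symm, χ.val_one.le⟩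
    · obtain ⟨g, rfl⟩ := QuotientGroup.mk_surjective q
      -- Multiplying by a high power of t ∈ H lowers χ below 0 within the same coset.
      obtain ⟨k, hk⟩ := exists_nat_gt (χ.val g / -χ.val t)
      refine ⟨g * t ^ k, fun h => (hq h).elim, QuotientGroup.mk_mul_of_mem g (pow_mem htH k), ?_⟩
      rw [div_lt_iff₀ (by linarith)] at hk
      rw [χ.val_mul, χ.val_pow]
      linarith
  choose ρ h1 h2 h3 using key
  exact ⟨ρ, h1 1 rfl, h2, h3⟩

/-- Since χ ≤ 0 on representatives, g ↦ g ρ(g)⁻¹ maps {χ ≥ 0} into H ∩ {χ ≥ 0}. Upwards, a path in H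
is completed by one step ρ(g); downwards, paths in G are projected. -/
theorem nonnegConnected_restrict_iff {χ : Character G} (hχ : χ ≠ 0) :
    NonnegConnected (Character.restrict H χ) ↔ NonnegConnected χ := by
  classical
  obtain ⟨ρ, hρ1, hρ, hρχ⟩ := exists_rep_val_nonpos H hχ
  have hmem (g : G) : g * (ρ g)⁻¹ ∈ H := by
    rw [← QuotientGroup.eq_one_iff, QuotientGroup.mk_mul, QuotientGroup.mk_inv, hρ,
      mul_inv_cancel]
  have hval (g : G) : χ.val g ≤ χ.val (g * (ρ g)⁻¹) := by
    rw [χ.val_mul, χ.val_inv]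
    linarith [hρχ g]
  constructor
  · rintro ⟨T, hT⟩
    refine ⟨T.image (↑) ∪ (Set.finite_range ρ).toFinset, fun g hg => ?_⟩
    have hg' := hg.trans (hval g)
    have h1 := (hT ⟨_, hmem g⟩ hg').lift
      (p := NonnegStep (↑(T.image ((↑) : H → G) ∪ (Set.finite_range ρ).toFinset)) χ)
      Subtype.val fun a b hab => ?_
    · refine h1.tail ⟨hg', hg, Or.inl ?_⟩
      rw [mul_inv_rev, inv_inv, inv_mul_cancel_right]
      simp
    · refine ⟨hab.1, hab.2.1, hab.2.2.imp (fun hs => ?_) fun hs => ?_⟩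
      all_goals
        rw [Finset.coe_union, Finset.coe_image]
        exact Or.inl ⟨_, hs, rfl⟩
  · rintro ⟨S, hS⟩
    let π : G → H := fun g => ⟨g * (ρ g)⁻¹, hmem g⟩
    -- Projected steps have the form ρ(a) s ρ(b)⁻¹, giving finitely many generators. The default 1
    -- only makes F total and is not needed on actual steps.
    let F : (G ⧸ H) × (G ⧸ H) × G → H := fun p =>
      if h : ρ p.1 * p.2.2 * (ρ p.2.1)⁻¹ ∈ H then ⟨_, h⟩ else 1
    have hFfin : (F '' (Set.univ ×ˢ Set.univ ×ˢ (S : Set G))).Finite :=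
      (Set.finite_univ.prod (Set.finite_univ.prod S.finite_toSet)).image F
    have hF {a b : G} (hs : a⁻¹ * b ∈ S) : (π a)⁻¹ * π b ∈ hFfin.toFinset := by
      rw [Set.Finite.mem_toFinset]
      refine ⟨(a, b, a⁻¹ * b), ⟨trivial, trivial, hs⟩, ?_⟩
      have heq : ρ a * (a⁻¹ * b) * (ρ b)⁻¹ = ((π a)⁻¹ * π b : H) := by
        simp only [π, Subgroup.coe_mul, Subgroup.coe_inv]
        group
      have hin : ρ a * (a⁻¹ * b) * (ρ b)⁻¹ ∈ H := by
        rw [heq]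
        exact SetLike.coe_mem _
      simp only [F]
      rw [dif_pos hin]
      exact Subtype.ext heq
    have hπ (h : H) : π h = h := by
      have : ((h : G) : G ⧸ H) = 1 := (QuotientGroup.eq_one_iff _).2 h.2
      ext
      simp only [π]
      rw [this, hρ1, inv_one, mul_one]
    refine ⟨hFfin.toFinset, fun h hh => ?_⟩
    -- The projection may identify adjacent vertices; this is harmless as `NonnegStep` does not
    -- require distinct endpoints.
    have h1 := (hS h hh).lift
      (p := NonnegStep (hFfin.toFinset : Set H) (Character.restrict H χ)) π fun a b hab => ?_
    · have h2 := hπ 1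
      rw [Subgroup.coe_one] at h2
      rwa [Function.onFun, hπ, h2] at h1
    · exact ⟨hab.1.trans (hval a), hab.2.1.trans (hval b), hab.2.2.imp hF hF⟩

end FiniteIndex

/-! ### An invariant character from the orbit of a vertex -/

section RChiInfty

variable {G : Type*} [Group G]

/-- The sum over the (finite) orbit of a transcendental vertex under the automorphism group is a
nonzero invariant character. -/
theorem InClassS.hasRChiInfty (hG : InClassS G) : HasRChiInfty G := by
  classical
  have hfg := hG.fg
  obtain ⟨g₀, -, hg₀⟩ := hG.hemisphere
  have hval {χ : Character G} (hχ : χ ≠ 0) (h : rayOfNeZero ℝ χ hχ ∈ (Sigma1 G)ᶜ) :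
      0 < χ.val g₀ := by
    obtain ⟨ψ, hψ, heq, hpos⟩ := hg₀ h
    obtain ⟨r, hr, rfl⟩ := ((ray_eq_iff hχ hψ).1 heq).symm.exists_pos_left hψ hχ
    rw [ψ.val_smul]
    exact mul_pos hr hpos
  obtain ⟨x, hx⟩ := hG.compl_nonempty
  have hC : connectedComponentIn (Sigma1 G)ᶜ x ∈ componentsOf (Sigma1 G)ᶜ := ⟨x, hx, rfl⟩
  obtain ⟨m, v, hv, ht⟩ := hG.polytopes _ hC
  obtain ⟨j⟩ : Nonempty (Fin m) := by
    obtain ⟨y, hy⟩ := nonempty_of_mem_componentsOf hC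
    rw [hv.eq_cone] at hy
    obtain ⟨a, h, -⟩ := hy
    by_contra hm
    rw [not_nonempty_iff] at hm
    exact h (Finset.sum_of_isEmpty _)
  set χ := v j
  have hχ : χ ≠ 0 := hv.ne_zero j
  have hne (φ : G ≃* G) : Character.precomp φ χ ≠ 0 :=
    (Character.precomp φ).map_ne_zero_iff.2 hχ
  have hvert (φ : G ≃* G) : rayOfNeZero ℝ _ (hne φ) ∈ vertexRays (Sigma1 G)ᶜ := by
    have := map_mem_vertexRays (Character.precomp φ) (Character.continuous_precomp φ)
      (Character.continuous_precomp φ.symm) (image_compl_Sigma1_precomp φ)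
      ⟨_, hC, m, v, hv, j, rfl⟩
    rwa [Module.Ray.map_apply] at this
  -- Two orbit members on one ray differ by a factor r by which ψ⁻¹ followed by φ scales χ;
  -- transcendence gives r = 1.
  have hinj {φ ψ : G ≃* G} (h : rayOfNeZero ℝ _ (hne φ) = rayOfNeZero ℝ _ (hne ψ)) :
      Character.precomp φ χ = Character.precomp ψ χ := by
    obtain ⟨r, hr, h1⟩ := ((ray_eq_iff _ _).1 h).symm.exists_pos_left (hne ψ) (hne φ)
    have h2 (g : G) : χ.val (φ g) = r * χ.val (ψ g) := by
      rw [← Character.val_precomp, ← h1]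
      rfl
    have hr1 : r = 1 := (ht j).eq_one_of_precomp_eq_smul hχ (θ := ψ.symm.trans φ) hr fun g => by
      simpa using h2 (ψ.symm g)
    rw [← h1, hr1, one_smul]
  let O : Set (Character G) := Set.range fun φ : G ≃* G => Character.precomp φ χ
  have hO : O.Finite := by
    have hfin : (Set.range fun φ : G ≃* G => rayOfNeZero ℝ _ (hne φ)).Finite :=
      (vertexRays_finite hG.finite_components).subset (Set.range_subset_iff.2 hvert)
    have hsub : O ⊆ ⋃ y ∈ Set.range fun φ : G ≃* G => rayOfNeZero ℝ _ (hne φ),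
        {ψ ∈ O | ∃ hψ : ψ ≠ 0, rayOfNeZero ℝ ψ hψ = y} := by
      rintro _ ⟨φ, rfl⟩
      exact Set.mem_biUnion ⟨φ, rfl⟩ ⟨⟨φ, rfl⟩, hne φ, rfl⟩
    refine (hfin.biUnion fun y _ => Set.Subsingleton.finite ?_).subset hsub
    rintro _ ⟨⟨φ, rfl⟩, _, hφ⟩ _ ⟨⟨ψ, rfl⟩, _, hψ⟩
    exact hinj (hφ.trans hψ.symm)
  refine ⟨∑ ψ ∈ hO.toFinset, ψ, fun h0 => ?_, fun φ g => ?_⟩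
  · have hpos : 0 < (∑ ψ ∈ hO.toFinset, ψ).val g₀ := by
      rw [Character.val_sum]
      refine Finset.sum_pos (fun ψ hψ => ?_) ⟨_, hO.mem_toFinset.2 ⟨MulEquiv.refl G, rfl⟩⟩
      obtain ⟨φ, rfl⟩ := hO.mem_toFinset.1 hψ
      exact hval (hne φ) (vertexRays_subset _ (hvert φ))
    rw [h0, Character.val_zero] at hpos
    exact hpos.false
  · rw [Character.val_sum, Character.val_sum]
    refine Finset.sum_equiv (Character.precomp φ).toEquiv (fun ψ => ?_) fun ψ _ => rfl
    simp only [Set.Finite.mem_toFinset]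
    constructor
    · rintro ⟨θ, rfl⟩
      exact ⟨φ.trans θ, rfl⟩
    · rintro ⟨θ, hθ⟩
      refine ⟨φ.symm.trans θ, ?_⟩
      apply (Character.precomp φ).injective
      refine Eq.trans ?_ hθ
      ext g
      simp

end RChiInfty

/-! ### Restriction of characters when the Betti numbers agree -/

section Restriction

variable {G : Type*} [Group G] (H : Subgroup G)

instance Abelianization.instFG [Group.FG G] : Group.FG (Abelianization G) :=
  QuotientGroup.fg (commutator G)

theorem mem_commutator_iff_of_eq_one {g : G} :
    g ∈ commutator G ↔ Abelianization.of g = 1 := by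
  rw [← Abelianization.ker_of, MonoidHom.mem_ker]

theorem Subgroup.index_cast_pos [H.FiniteIndex] : (0 : ℝ) < H.index :=
  Nat.cast_pos.2 (Nat.pos_of_ne_zero H.index_ne_zero_of_finite)

variable [H.Normal] [H.FiniteIndex]

/-- If `b₁(H) = b₁(G)`, characters of `H` vanish on the commutator subgroup of `G`. -/
theorem Character.val_eq_zero_of_coe_mem_commutator [Group.FG G]
    (hb : firstBetti H = firstBetti G) (χ : Character H) {h : H} (hh : (h : G) ∈ commutator G) :
    χ.val h = 0 := by
  have : Group.FG H := inferInstance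
  have hfinG : Module.Finite ℤ (Additive (Abelianization G)) :=
    Module.Finite.iff_addGroup_fg.2 inferInstance
  have hfinH : Module.Finite ℤ (Additive (Abelianization H)) :=
    Module.Finite.iff_addGroup_fg.2 inferInstance
  let f : Additive (Abelianization H) →ₗ[ℤ] Additive (Abelianization G) :=
    (MonoidHom.toAdditive (Abelianization.map H.subtype)).toIntLinearMap
  have hquot : Module.finrank ℤ (Additive (Abelianization G) ⧸ LinearMap.range f) = 0 := by
    rw [Module.finrank_eq_zero_iff]
    intro x
    obtain ⟨y, rfl⟩ := Submodule.Quotient.mk_surjective _ x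
    obtain ⟨g, hg⟩ := QuotientGroup.mk_surjective y.toMul
    -- The index kills the cokernel, because g ^ `H.index` lies in H.
    refine ⟨H.index, Nat.cast_ne_zero.2 H.index_ne_zero_of_finite, ?_⟩
    rw [← Submodule.Quotient.mk_smul, Submodule.Quotient.mk_eq_zero]
    refine ⟨Additive.ofMul (Abelianization.of ⟨_, H.pow_index_mem g⟩), ?_⟩
    have hy : y = Additive.ofMul (Abelianization.of g) := hg.symm
    rw [hy, natCast_zsmul, ← ofMul_pow, ← map_pow]
    rfl
  have h1 := Submodule.finrank_quotient_add_finrank (LinearMap.range f)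
  have h2 := Submodule.finrank_quotient_add_finrank (LinearMap.ker f)
  have h3 := f.quotKerEquivRange.finrank_eq
  -- Rank-nullity: the image has the full rank b₁(G) = b₁(H), leaving rank 0 for the kernel.
  have hker : Module.finrank ℤ (LinearMap.ker f) = 0 := by
    unfold firstBetti at hb
    omega
  rw [Module.finrank_eq_zero_iff] at hker
  have hmem : Additive.ofMul (Abelianization.of h) ∈ LinearMap.ker f :=
    congrArg Additive.ofMul (mem_commutator_iff_of_eq_one.1 hh)
  obtain ⟨n, hn, hn0⟩ := hker ⟨_, hmem⟩
  have h4 : h ^ n ∈ commutator H := by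
    rw [mem_commutator_iff_of_eq_one, map_zpow]
    exact congrArg Additive.toMul (congrArg Subtype.val hn0)
  have h5 : n • χ.val h = χ.val (h ^ n) := (map_zsmul χ n (Additive.ofMul h)).symm
  rw [χ.val_eq_zero_of_mem_commutator h4, smul_eq_zero] at h5
  exact h5.resolve_left hn

/-- Extension of characters from a finite index normal subgroup with the same first Betti
number. -/
noncomputable def Character.extend [Group.FG G] (hb : firstBetti H = firstBetti G) (χ : Character H) :
    Character G :=
  ofVal (fun g => χ.val ⟨g ^ H.index, H.pow_index_mem g⟩ / H.index) fun g k => by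
    rw [← add_div, ← χ.val_mul]
    congr 1
    -- The elements (gk)^n and g^n k^n agree in the abelianization of G, so χ does not distinguish
    -- them.
    rw [← sub_eq_zero, sub_eq_add_neg, ← χ.val_inv, ← χ.val_mul]
    refine χ.val_eq_zero_of_coe_mem_commutator H hb ?_
    simp [mem_commutator_iff_of_eq_one, mul_pow]

/-- Restriction of characters, as an isomorphism. -/
noncomputable def Character.restrictEquiv [Group.FG G] (hb : firstBetti H = firstBetti G) :
    Character G ≃ₗ[ℝ] Character H where
  __ := restrict H
  invFun χ := extend H hb χ
  left_inv χ := by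
    ext g
    change χ.val (g ^ H.index) / H.index = _
    rw [χ.val_pow, mul_div_cancel_left₀ _ H.index_cast_pos.ne']
  right_inv χ := by
    ext h
    change χ.val (h ^ H.index) / H.index = _
    rw [χ.val_pow, mul_div_cancel_left₀ _ H.index_cast_pos.ne']

theorem Character.continuous_restrictEquiv [Group.FG G] (hb : firstBetti H = firstBetti G) :
    Continuous (restrictEquiv H hb) :=
  continuous_iff.2 fun h => continuous_val (h : G)

theorem Character.continuous_restrictEquiv_symm [Group.FG G]
    (hb : firstBetti H = firstBetti G) : Continuous (restrictEquiv H hb).symm :=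
  continuous_iff.2 fun _ => (continuous_val _).div_const _

theorem Sigma1_eq_image_restrictEquiv [Group.FG G] (hb : firstBetti H = firstBetti G) :
    Sigma1 H = Module.Ray.map (Character.restrictEquiv H hb) '' Sigma1 G :=
  Sigma1_eq_image _ fun _ hχ => nonnegConnected_restrict_iff H hχ

theorem InClassS.of_finiteIndex [Group.FG G] (hb : firstBetti H = firstBetti G)
    (hG : InClassS G) : InClassS H := by
  let e := Character.restrictEquiv H hb
  have hcompl : (Sigma1 H)ᶜ = Module.Ray.map e '' (Sigma1 G)ᶜ := by
    rw [Sigma1_eq_image_restrictEquiv H hb, Set.image_compl_eq (Module.Ray.map e).bijective]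
  have hcomp : componentsOf (Sigma1 H)ᶜ =
      Set.image (Module.Ray.map e) '' componentsOf (Sigma1 G)ᶜ := by
    rw [hcompl]
    exact componentsOf_image (CharacterSphere.mapHomeomorph e
      (Character.continuous_restrictEquiv H hb) (Character.continuous_restrictEquiv_symm H hb)) _
  have hne : (Sigma1 H)ᶜ.Nonempty := hcompl ▸ hG.compl_nonempty.image _
  refine ⟨inferInstance, hne, ?_, hcomp ▸ hG.finite_components.image _, ?_⟩
  · obtain ⟨g, -, hg⟩ := hG.hemisphere
    have hsub : (Sigma1 H)ᶜ ⊆ openHemisphere ⟨g ^ H.index, H.pow_index_mem g⟩ := by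
      rw [hcompl]
      rintro _ ⟨x, hx, rfl⟩
      obtain ⟨χ, hχ, rfl, hpos⟩ := hg hx
      refine ⟨e χ, e.map_ne_zero_iff.2 hχ, Module.Ray.map_apply _ _ _, ?_⟩
      change 0 < χ.val (g ^ H.index)
      rw [χ.val_pow]
      exact mul_pos H.index_cast_pos hpos
    -- The complement of Σ¹ is nonempty, so some character is positive on this element, which
    -- therefore is not in the commutator subgroup.
    refine ⟨_, fun hmem => ?_, hsub⟩
    obtain ⟨x, hx⟩ := hne
    obtain ⟨χ, -, -, hpos⟩ := hsub hx
    exact hpos.ne' (χ.val_eq_zero_of_mem_commutator hmem)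
  · rw [hcomp]
    rintro _ ⟨C, hC, rfl⟩
    obtain ⟨m, v, hv, ht⟩ := hG.polytopes C hC
    exact ⟨m, _, hv.map e, fun j a b ha hb' => ht j a b ha hb'⟩

end Restriction

theorem lemma3p6 {G : Type*} [Group G] (H : Subgroup G) [H.Normal] [H.FiniteIndex]
    (hb : firstBetti H = firstBetti G) (hG : InClassS G) :
    InClassS H ∧ HasRChiInfty H ∧
      ∃ e : Character G ≃ₗ[ℝ] Character H,
        (∀ (χ : Character G) (h : H), (e χ).val h = χ.val (h : G)) ∧
        Sigma1 H = Module.Ray.map e '' Sigma1 G := by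
  have hfg := hG.fg
  have hH := hG.of_finiteIndex H hb
  exact ⟨hH, hH.hasRChiInfty, Character.restrictEquiv H hb, fun _ _ => rfl,
    Sigma1_eq_image_restrictEquiv H hb⟩
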